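/- Let $\pi\colon C\to\operatorname{Spec}\mathbb C$ be a smooth algebraic curve over $\mathbb C$, i.e. a scheme with a structure morphism smooth of relative dimension $1$ (for instance a smooth irreducible projective curve), with tangent sheaf $T_C=\mathcal{D}er_{\mathbb C}(\mathcal O_C,\mathcal O_C)$. For an integer $n\ge 1$ let $Z_n=\operatorname{Spec}\mathbb C[t]/(t^n)$, let $\mathcal A_n=\mathcal O_C[t]/(t^n)$ be the structure sheaf of $C\times Z_n$, viewed as a sheaf of $\mathbb C$-algebras on $C$, and let $\mathcal G_n$ be the sheaf of groups on $C$ whose sections over an open $U$ are the automorphisms of the sheaf of $\mathbb C$-algebras $\mathcal A_n|_U$ which commute with the projection $\mathcal A_n|_U\to\mathcal O_U$, $t\mapsto 0$. For $n\geq 2$, every section of $\mathcal G_n$ preserves the ideal $(t^{n-1})=\ker(\mathcal A_n\to\mathcal A_{n-1})$, which defines a morphism of sheaves of groups $\rho_n\colon\mathcal G_n\to\mathcal G_{n-1}$. For an open $U\subseteq C$, a vector field $\sigma\in T_C(U)$ and $\mu,\nu\in\mathcal A_n(U)$ with $\nu$ invertible, write $\phi^\sigma_{\mu\nu}$ for the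 section of $\mathcal G_n$ over $U$, if it exists (it is then unique), given on every open $V\subseteq U$ by $$\phi^\sigma_{\mu\nu}(\alpha)=\sum_{k=0}^{n-1}\frac1{k!}\,\sigma^k(\alpha)\,(\mu t)^k\quad(\alpha\in\mathcal O_C(V)),\qquad \phi^\sigma_{\mu\nu}(t)=\nu t .$$ Let $n\ge 3$. Then the kernel of $\rho_n$ is abelian, and there is a morphism of sheaves of groups $\lambda\colon T_C\oplus\mathcal O_C\to\mathcal G_n$ such that, for every open $U$, every $\sigma\in T_C(U)$ (in particular every generator $\sigma$ of $T_C|_U$) and all $\theta,\beta\in\mathcal O_C(U)$, the automorphism $\phi^\sigma_{\theta t^{n-2},\,1+\beta t^{n-2}}$ exists and $$\lambda(\theta\sigma,\beta)=\phi^\sigma_{\theta t^{n-2},\,1+\beta t^{n-2}} ,$$ and such that $\lambda$ is an isomorphism of sheaves of groups of $T_C\oplus\mathcal O_C$ onto $\ker(\rho_n)$. Moreover $\rho_n$ is surjective as a morphism of sheaves (i.e. locally surjective), so that one has an exact sequence of sheaves of groups $$0\longrightarrow T_C\oplus\mathcal O_C\xrightarrow{\ \lambda\ }\mathcal G_n\xrightarrow{\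 \rho_n\ }\mathcal G_{n-1}\longrightarrow 0 .$$ -/

import Mathlib

open CategoryTheory AlgebraicGeometry TopologicalSpace Opposite Polynomial

namespace PrimitiveCurves

noncomputable section

variable {C : Scheme.{0}} (π : C ⟶ Spec (CommRingCat.of ℂ))

/-! ### The structure sheaf of a scheme over `ℂ` -/

/-- The sections `𝒪_C(U)`, as a `ℂ`-algebra through the structure morphism `π`. -/
def Reg (_ : C ⟶ Spec (CommRingCat.of ℂ)) (U : C.Opens) : Type := Γ(C, U)

instance (U : C.Opens) : CommRing (Reg π U) := inferInstanceAs (CommRing Γ(C, U))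

/-- The ring homomorphism `ℂ → 𝒪_C(U)` given by the structure morphism `π`. -/
def scalars (U : C.Opens) : ℂ →+* Reg π U :=
  ((Scheme.ΓSpecIso (CommRingCat.of ℂ)).inv ≫ π.appLE ⊤ U le_top).hom

instance (U : C.Opens) : Algebra ℂ (Reg π U) := (scalars π U).toAlgebra

/-- The restriction `𝒪_C(U) → 𝒪_C(V)` for `V ≤ U`, a morphism of `ℂ`-algebras. -/
def res {U V : C.Opens} (h : V ≤ U) : Reg π U →ₐ[ℂ] Reg π V where
  __ := (C.presheaf.map (homOfLE h).op).hom
  commutes' c := by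
    have e : ((Scheme.ΓSpecIso (CommRingCat.of ℂ)).inv ≫ π.appLE ⊤ U le_top) ≫
        C.presheaf.map (homOfLE h).op =
        (Scheme.ΓSpecIso (CommRingCat.of ℂ)).inv ≫ π.appLE ⊤ V le_top := by
      exact (Category.assoc _ _ _).trans (congrArg _ (Scheme.Hom.appLE_map π _ _))
    exact congrArg (fun f ↦ f.hom c) e

theorem res_self {U : C.Opens} (a : Reg π U) : res π le_rfl a = a := by
  have e : C.presheaf.map (homOfLE (le_refl U)).op = 𝟙 _ := C.presheaf.map_id _
  exact congrArg (fun f ↦ f.hom a) e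

theorem res_res {U V W : C.Opens} (h : V ≤ U) (h' : W ≤ V) (a : Reg π U) :
    res π h' (res π h a) = res π (h'.trans h) a := by
  have e : C.presheaf.map (homOfLE h).op ≫ C.presheaf.map (homOfLE h').op =
      C.presheaf.map (homOfLE (h'.trans h)).op := (C.presheaf.map_comp _ _).symm
  exact congrArg (fun f ↦ f.hom a) e

theorem reg_ext {ι : Type} {V : C.Opens} (W : ι → C.Opens) (le : ∀ i, W i ≤ V)
    (cov : V ≤ iSup W) {a b : Reg π V} (h : ∀ i, res π (le i) a = res π (le i) b) : a = b :=
  C.sheaf.eq_of_locally_eq' W V (fun i ↦ homOfLE (le i)) cov a b h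

theorem reg_glue {ι : Type} {V : C.Opens} (W : ι → C.Opens) (le : ∀ i, W i ≤ V)
    (cov : V ≤ iSup W) (s : ∀ i, Reg π (W i))
    (hs : ∀ i j Z (hi : Z ≤ W i) (hj : Z ≤ W j), res π hi (s i) = res π hj (s j)) :
    ∃ a : Reg π V, ∀ i, res π (le i) a = s i :=
  (C.sheaf.existsUnique_gluing' W V (fun i ↦ homOfLE (le i)) cov s
    (fun i j ↦ hs i j _ inf_le_left inf_le_right)).exists

/-! ### The sheaf of algebras `𝒜_n` of `C × Spec ℂ[t]/(t^n)` -/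

/-- `𝒜_n(U) = 𝒪_C(U)[t]/(t^n)`. -/
abbrev A (n : ℕ) (U : C.Opens) : Type := AdjoinRoot (X ^ n : (Reg π U)[X])

/-- The class of `t` in `𝒜_n(U)`. -/
abbrev t (n : ℕ) (U : C.Opens) : A π n U := AdjoinRoot.root _

/-- The inclusion `𝒪_C(U) → 𝒜_n(U)`. -/
abbrev incl (n : ℕ) (U : C.Opens) : Reg π U →+* A π n U := AdjoinRoot.of _

/-- The restriction `𝒜_n(U) → 𝒜_n(V)` for `V ≤ U`. -/
def resA (n : ℕ) {U V : C.Opens} (h : V ≤ U) : A π n U →ₐ[ℂ] A π n V :=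
  AdjoinRoot.mapAlgHom (res π h) _ _ (by simp)

/-- The truncation `𝒜_n(U) → 𝒜_m(U)` for `m ≤ n`. -/
def trunc {m n : ℕ} (h : m ≤ n) (U : C.Opens) : A π n U →ₐ[ℂ] A π m U :=
  AdjoinRoot.mapAlgHom (AlgHom.id ℂ _) _ _ (by simpa using pow_dvd_pow _ h)

section lemmas

variable {π} {n : ℕ} {U V W : C.Opens}

@[simp] theorem resA_incl (h : V ≤ U) (a : Reg π U) :
    resA π n h (incl π n U a) = incl π n V (res π h a) := by simp [resA]

@[simp] theorem resA_t (h : V ≤ U) : resA π n h (t π n U) = t π n V := by simp [resA]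

@[simp] theorem trunc_incl {m : ℕ} (h : m ≤ n) (a : Reg π U) :
    trunc π h U (incl π n U a) = incl π m U a := by simp [trunc]

@[simp] theorem trunc_t {m : ℕ} (h : m ≤ n) : trunc π h U (t π n U) = t π m U := by simp [trunc]

theorem t_pow : t π n U ^ n = 0 := by
  have := AdjoinRoot.eval₂_root (X ^ n : (Reg π U)[X])
  simpa using this

/-- Two ring homomorphisms on `𝒜_n(U)` agree when they agree on `𝒪_C(U)` and at `t`. -/
theorem ringHom_ext {R : Type*} [CommRing R] {f g : A π n U →+* R}
    (h₁ : ∀ a, f (incl π n U a) = g (incl π n U a)) (h₂ : f (t π n U) = g (t π n U)) :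
    f = g := by
  refine Ideal.Quotient.ringHom_ext (Polynomial.ringHom_ext h₁ h₂)

theorem resA_self (a : A π n U) : resA π n le_rfl a = a := by
  have : (resA π n le_rfl : A π n U →ₐ[ℂ] A π n U).toRingHom = RingHom.id _ :=
    ringHom_ext (fun a ↦ by simp [res_self]) (by simp)
  exact congrArg (fun f ↦ f a) this

theorem resA_resA (h : V ≤ U) (h' : W ≤ V) (a : A π n U) :
    resA π n h' (resA π n h a) = resA π n (h'.trans h) a := by
  have : ((resA π n h').comp (resA π n h)).toRingHom = (resA π n (h'.trans h)).toRingHom :=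
    ringHom_ext (fun a ↦ by simp [res_res]) (by simp)
  exact congrArg (fun f ↦ f a) this

theorem trunc_resA {m : ℕ} (hm : m ≤ n) (h : V ≤ U) (a : A π n U) :
    trunc π hm V (resA π n h a) = resA π m h (trunc π hm U a) := by
  have : ((trunc π hm V).comp (resA π n h)).toRingHom =
      ((resA π m h).comp (trunc π hm U)).toRingHom :=
    ringHom_ext (fun a ↦ by simp) (by simp)
  exact congrArg (fun f ↦ f a) this

theorem trunc_surjective {m : ℕ} (hm : m ≤ n) : Function.Surjective (trunc π hm U) := by
  intro a
  obtain ⟨p, rfl⟩ := AdjoinRoot.mk_surjective a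
  refine ⟨AdjoinRoot.mk _ p, ?_⟩
  have : (trunc π hm U).toRingHom.comp (AdjoinRoot.mk _) = AdjoinRoot.mk _ :=
    Polynomial.ringHom_ext (fun a ↦ by simp [trunc]) (by simp [trunc])
  exact congrArg (fun f ↦ f p) this

theorem trunc_eq_zero_iff {m : ℕ} (hm : m ≤ n) (a : A π n U) :
    trunc π hm U a = 0 ↔ a ∈ Ideal.span {t π n U ^ m} := by
  obtain ⟨p, rfl⟩ := AdjoinRoot.mk_surjective a
  have : (trunc π hm U).toRingHom.comp (AdjoinRoot.mk _) = AdjoinRoot.mk _ :=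
    Polynomial.ringHom_ext (fun a ↦ by simp [trunc]) (by simp [trunc])
  have h1 : trunc π hm U (AdjoinRoot.mk _ p) = AdjoinRoot.mk _ p := congrArg (fun f ↦ f p) this
  rw [h1]
  constructor
  · intro h
    obtain ⟨q, rfl⟩ := AdjoinRoot.mk_eq_zero.1 h
    rw [Ideal.mem_span_singleton]
    exact ⟨AdjoinRoot.mk _ q, by simp⟩
  · intro h
    obtain ⟨b, hb⟩ := Ideal.mem_span_singleton.1 h
    have h2 := congrArg (trunc π hm U) hb
    rw [h1, map_mul, map_pow, trunc_t, t_pow, zero_mul] at h2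
    exact h2

end lemmas

/-- The projection `𝒜_n(U) → 𝒪_C(U)`, `t ↦ 0`, for `n ≥ 1`. -/
def aug {n : ℕ} (hn : n ≠ 0) (U : C.Opens) : A π n U →ₐ[ℂ] Reg π U :=
  AdjoinRoot.liftAlgHom _ (AlgHom.id ℂ _) 0 (by simp [hn])

section lemmas

variable {π} {n : ℕ} {U V W : C.Opens}

theorem aug_resA (hn : n ≠ 0) (h : V ≤ U) (a : A π n U) :
    aug π hn V (resA π n h a) = res π h (aug π hn U a) := by
  have : ((aug π hn V).comp (resA π n h)).toRingHom =
      ((res π h).comp (aug π hn U)).toRingHom :=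
    ringHom_ext (fun a ↦ by simp [aug]) (by simp [aug])
  exact congrArg (fun f ↦ f a) this

theorem aug_trunc {m : ℕ} (hm : m ≤ n) (hn : n ≠ 0) (hm' : m ≠ 0) (a : A π n U) :
    aug π hm' U (trunc π hm U a) = aug π hn U a := by
  have : ((aug π hm' U).comp (trunc π hm U)).toRingHom = (aug π hn U).toRingHom :=
    ringHom_ext (fun a ↦ by simp [aug]) (by simp [aug])
  exact congrArg (fun f ↦ f a) this

theorem aug_eq_zero_iff (hn : n ≠ 0) (a : A π n U) :
    aug π hn U a = 0 ↔ a ∈ Ideal.span {t π n U} := by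
  constructor
  · intro h
    obtain ⟨p, rfl⟩ := AdjoinRoot.mk_surjective a
    have h' : p.coeff 0 = 0 := by
      rw [aug, AdjoinRoot.liftAlgHom_mk] at h
      rw [coeff_zero_eq_eval_zero, Polynomial.eval]
      exact h
    obtain ⟨q, rfl⟩ := X_dvd_iff.2 h'
    rw [Ideal.mem_span_singleton]
    exact ⟨AdjoinRoot.mk _ q, by simp⟩
  · intro h
    obtain ⟨b, rfl⟩ := Ideal.mem_span_singleton.1 h
    simp [aug]

/-- The coefficient of `t ^ k` of a section of `𝒜_n`. -/
def coef (k : ℕ) (a : A π n U) : Reg π U :=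
  (AdjoinRoot.modByMonicHom (monic_X_pow n) a).coeff k

theorem coef_resA (h : V ≤ U) (k : ℕ) (a : A π n U) :
    coef k (resA π n h a) = res π h (coef k a) := by
  obtain ⟨p, rfl⟩ := AdjoinRoot.mk_surjective a
  have : (resA π n h).toRingHom.comp (AdjoinRoot.mk _) =
      (AdjoinRoot.mk _).comp (mapRingHom (res π h).toRingHom) :=
    Polynomial.ringHom_ext (fun a ↦ by simp [resA]) (by simp [resA])
  have h1 : resA π n h (AdjoinRoot.mk _ p) = AdjoinRoot.mk _ (p.map (res π h).toRingHom) :=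
    congrArg (fun f ↦ f p) this
  have h2 := map_modByMonic (res π h).toRingHom (p := p) (monic_X_pow n)
  rw [Polynomial.map_pow, map_X] at h2
  rw [h1, coef, coef, AdjoinRoot.modByMonicHom_mk, AdjoinRoot.modByMonicHom_mk, ← h2, coeff_map]
  rfl

theorem coef_ext {a b : A π n U} (h : ∀ k, coef k a = coef k b) : a = b :=
  (AdjoinRoot.mk_leftInverse (monic_X_pow n)).injective (Polynomial.ext h)

theorem A_ext {ι : Type} (W : ι → C.Opens) (le : ∀ i, W i ≤ V)
    (cov : V ≤ iSup W) {a b : A π n V} (h : ∀ i, resA π n (le i) a = resA π n (le i) b) :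
    a = b :=
  coef_ext fun k ↦ reg_ext π W le cov fun i ↦ by rw [← coef_resA, ← coef_resA, h]

theorem sum_coef (a : A π n U) :
    ∑ k ∈ Finset.range n, incl π n U (coef k a) * t π n U ^ k = a := by
  conv_rhs => rw [← AdjoinRoot.mk_leftInverse (monic_X_pow n) a]
  rcases subsingleton_or_nontrivial (Reg π U) with hs | hs
  · have := (AdjoinRoot.of (X ^ n : (Reg π U)[X])).codomain_trivial
    exact Subsingleton.elim _ _
  rcases Nat.eq_zero_or_pos n with rfl | hn
  · rw [← mul_one a, ← pow_zero (t π 0 U), t_pow]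
    simp
  have hd : (AdjoinRoot.modByMonicHom (monic_X_pow n) a).natDegree < n := by
    obtain ⟨p, rfl⟩ := AdjoinRoot.mk_surjective a
    rw [AdjoinRoot.modByMonicHom_mk]
    have := natDegree_modByMonic_lt p (monic_X_pow (R := Reg π U) n)
      (fun h ↦ by simpa [hn.ne'] using congrArg natDegree h)
    simpa using this
  conv_rhs => rw [as_sum_range' _ n hd]
  simp [coef, ← C_mul_X_pow_eq_monomial]

theorem A_glue {ι : Type} (W : ι → C.Opens) (le : ∀ i, W i ≤ V)
    (cov : V ≤ iSup W) (s : ∀ i, A π n (W i))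
    (hs : ∀ i j Z (hi : Z ≤ W i) (hj : Z ≤ W j), resA π n hi (s i) = resA π n hj (s j)) :
    ∃ a : A π n V, ∀ i, resA π n (le i) a = s i := by
  have key (k : ℕ) : ∃ a : Reg π V, ∀ i, res π (le i) a = coef k (s i) :=
    reg_glue π W le cov _ fun i j Z hi hj ↦ by rw [← coef_resA, ← coef_resA, hs i j]
  choose c hc using key
  refine ⟨∑ k ∈ Finset.range n, incl π n V (c k) * t π n V ^ k, fun i ↦ ?_⟩
  rw [map_sum, ← sum_coef (s i)]
  exact Finset.sum_congr rfl fun k _ ↦ by rw [map_mul, map_pow, resA_incl, resA_t, hc]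

end lemmas

/-- Gluing of compatible local endomorphisms of a sheaf of sets. -/
theorem glue_end {F : C.Opens → Type} (r : ∀ {U V : C.Opens}, V ≤ U → F U → F V)
    (r_r : ∀ {U V Z : C.Opens} (h : V ≤ U) (h' : Z ≤ V) (a : F U),
      r h' (r h a) = r (h'.trans h) a)
    (_ : ∀ {ι : Type} {V : C.Opens} (W : ι → C.Opens) (le : ∀ i, W i ≤ V) (_ : V ≤ iSup W)
      {a b : F V}, (∀ i, r (le i) a = r (le i) b) → a = b)
    (glue : ∀ {ι : Type} {V : C.Opens} (W : ι → C.Opens) (le : ∀ i, W i ≤ V) (_ : V ≤ iSup W)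
      (s : ∀ i, F (W i)),
      (∀ i j Z (hi : Z ≤ W i) (hj : Z ≤ W j), r hi (s i) = r hj (s j)) →
        ∃ a : F V, ∀ i, r (le i) a = s i)
    {ι : Type} (W : ι → C.Opens) (e : ∀ i Z, Z ≤ W i → F Z → F Z)
    (he : ∀ i Z Z' (h : Z ≤ W i) (h' : Z' ≤ Z) (a : F Z),
      r h' (e i Z h a) = e i Z' (h'.trans h) (r h' a))
    (hc : ∀ i j Z (hi : Z ≤ W i) (hj : Z ≤ W j) (a : F Z), e i Z hi a = e j Z hj a)
    (V : C.Opens) (hV : V ≤ iSup W) :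
    ∃ E : F V → F V, ∀ i Z (hi : Z ≤ W i) (hZ : Z ≤ V) (a : F V),
      r hZ (E a) = e i Z hi (r hZ a) := by
  have cov : V ≤ ⨆ i, V ⊓ W i := by rw [← inf_iSup_eq]; exact le_inf le_rfl hV
  have key (a : F V) : ∃ b : F V, ∀ i, r inf_le_left b =
      e i (V ⊓ W i) inf_le_right (r inf_le_left a) :=
    glue (fun i ↦ V ⊓ W i) (fun i ↦ inf_le_left) cov _ fun i j Z hi hj ↦ by
      rw [he, he, r_r, r_r]; exact hc ..
  choose E hE using key
  refine ⟨E, fun i Z hi hZ a ↦ ?_⟩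
  rw [← r_r (inf_le_left : V ⊓ W i ≤ V) (le_inf hZ hi), hE, he, r_r]

/-! ### The sheaf of groups `𝒢_n` -/

/-- `𝒢_n(U)`: the automorphisms of the sheaf of `ℂ`-algebras `𝒜_n|_U` that are compatible with the
projection `𝒜_n → 𝒪_C`. -/
@[ext]
structure GAut (n : ℕ) (U : C.Opens) : Type where
  /-- the automorphism of `𝒜_n(V)`, for `V ≤ U` -/
  on : ∀ V : C.Opens, V ≤ U → (A π n V ≃ₐ[ℂ] A π n V)
  resA_on : ∀ {V W : C.Opens} (h : V ≤ U) (h' : W ≤ V) (a : A π n V),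
    resA π n h' (on V h a) = on W (h'.trans h) (resA π n h' a)
  aug_on : ∀ {V : C.Opens} (h : V ≤ U) (hn : n ≠ 0) (a : A π n V),
    aug π hn V (on V h a) = aug π hn V a

/-- The group law of `𝒢_n(U)` is the composition of automorphisms. -/
instance (n : ℕ) (U : C.Opens) : Group (GAut π n U) where
  mul g g' :=
    { on V h := (g'.on V h).trans (g.on V h)
      resA_on h h' a := by simp [g.resA_on, g'.resA_on]
      aug_on h hn a := by simp [g.aug_on, g'.aug_on] }
  one := { on V h := AlgEquiv.refl, resA_on _ _ _ := rfl, aug_on _ _ _ := rfl }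
  inv g :=
    { on V h := (g.on V h).symm
      resA_on h h' a := by
        apply (g.on _ (h'.trans h)).injective
        rw [← g.resA_on h h', AlgEquiv.apply_symm_apply, AlgEquiv.apply_symm_apply]
      aug_on h hn a := by rw [← g.aug_on h hn, AlgEquiv.apply_symm_apply] }
  mul_assoc _ _ _ := rfl
  one_mul _ := rfl
  mul_one _ := rfl
  inv_mul_cancel g := by
    refine GAut.ext (funext fun V ↦ funext fun h ↦ AlgEquiv.ext fun a ↦ ?_)
    exact (g.on V h).symm_apply_apply a

section lemmas

variable {π} {n : ℕ} {U V W : C.Opens}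

theorem GAut.ext' {g g' : GAut π n U} (H : ∀ V h a, g.on V h a = g'.on V h a) : g = g' :=
  GAut.ext (funext fun V ↦ funext fun h ↦ AlgEquiv.ext (H V h))

theorem GAut.on_mul (g g' : GAut π n U) (V : C.Opens) (h : V ≤ U) (a : A π n V) :
    (g * g').on V h a = g.on V h (g'.on V h a) := rfl

end lemmas

/-- The restriction `𝒢_n(U) → 𝒢_n(V)` for `V ≤ U`. -/
def GAut.restrict (n : ℕ) {U V : C.Opens} (h : V ≤ U) : GAut π n U →* GAut π n V where
  toFun g :=
    { on W h' := g.on W (h'.trans h)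
      resA_on h' := g.resA_on (h'.trans h)
      aug_on h' := g.aug_on (h'.trans h) }
  map_one' := rfl
  map_mul' _ _ := rfl

/-- `𝒢_n` as a presheaf of groups on `C`. -/
def autPresheaf (n : ℕ) : TopCat.Presheaf GrpCat.{0} C.toPresheafedSpace.carrier where
  obj U := GrpCat.of (GAut π n U.unop)
  map i := GrpCat.ofHom (GAut.restrict π n i.unop.le)
  map_id _ := rfl
  map_comp _ _ := rfl

theorem autPresheaf_isSheaf (n : ℕ) : (autPresheaf π n).IsSheaf := by
  rw [TopCat.Presheaf.isSheaf_iff_isSheafUniqueGluing]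
  intro ι W sf hsf
  let g (i : ι) : GAut π n (W i) := sf i
  have cpt (i j : ι) : GAut.restrict π n inf_le_left (g i) =
      GAut.restrict π n (inf_le_right : W i ⊓ W j ≤ W j) (g j) := hsf i j
  have hc (i j : ι) (Z : C.Opens) (hi : Z ≤ W i) (hj : Z ≤ W j) :
      (g i).on Z hi = (g j).on Z hj :=
    congrArg (fun g : GAut π n (W i ⊓ W j) ↦ g.on Z (le_inf hi hj)) (cpt i j)
  have key := glue_end (F := A π n) (fun h ↦ resA π n h) resA_resA A_ext A_glue W
    (fun i Z h ↦ (g i).on Z h) (fun i Z Z' h h' a ↦ (g i).resA_on h h' a)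
    (fun i j Z hi hj a ↦ by rw [hc i j Z hi hj])
  have key' := glue_end (F := A π n) (fun h ↦ resA π n h) resA_resA A_ext A_glue W
    (fun i Z h ↦ (g i)⁻¹.on Z h) (fun i Z Z' h h' a ↦ (g i)⁻¹.resA_on h h' a)
    (fun i j Z hi hj a ↦ congrArg (fun f ↦ f.symm a) (hc i j Z hi hj))
  choose E hE using key
  choose E' hE' using key'
  have aext {V : C.Opens} (hV : V ≤ iSup W) {a b : A π n V}
      (h : ∀ i Z (_ : Z ≤ W i) (hZ : Z ≤ V), resA π n hZ a = resA π n hZ b) : a = b :=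
    A_ext (fun i ↦ V ⊓ W i) (fun i ↦ inf_le_left)
      (by rw [← inf_iSup_eq]; exact le_inf le_rfl hV) fun i ↦ h i _ inf_le_right _
  let G (V : {V : C.Opens // V ≤ iSup W}) : A π n V.1 ≃ₐ[ℂ] A π n V.1 :=
    { toFun := E V.1 V.2
      invFun := E' V.1 V.2
      left_inv a := aext V.2 fun i Z hi hZ ↦ by
        rw [hE' V.1 V.2 i Z hi hZ, hE V.1 V.2 i Z hi hZ]
        exact ((g i).on Z hi).symm_apply_apply _
      right_inv a := aext V.2 fun i Z hi hZ ↦ by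
        rw [hE V.1 V.2 i Z hi hZ, hE' V.1 V.2 i Z hi hZ]
        exact ((g i).on Z hi).apply_symm_apply _
      map_add' a b := aext V.2 fun i Z hi hZ ↦ by
        rw [map_add, hE V.1 V.2 i Z hi hZ, hE V.1 V.2 i Z hi hZ, hE V.1 V.2 i Z hi hZ,
          map_add, map_add]
      map_mul' a b := aext V.2 fun i Z hi hZ ↦ by
        rw [map_mul, hE V.1 V.2 i Z hi hZ, hE V.1 V.2 i Z hi hZ, hE V.1 V.2 i Z hi hZ,
          map_mul, map_mul]
      commutes' c := aext V.2 fun i Z hi hZ ↦ by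
        rw [hE V.1 V.2 i Z hi hZ, AlgHom.commutes, AlgEquiv.commutes] }
  have hG (V : {V : C.Opens // V ≤ iSup W}) (i : ι) (Z : C.Opens) (hi : Z ≤ W i) (hZ : Z ≤ V.1)
      (a : A π n V.1) : resA π n hZ (G V a) = (g i).on Z hi (resA π n hZ a) :=
    hE V.1 V.2 i Z hi hZ a
  let T : GAut π n (iSup W) :=
    { on V h := G ⟨V, h⟩
      resA_on {V V'} h h' a := aext (h'.trans h) fun i Z hi hZ ↦ by
        rw [resA_resA, hG ⟨V, h⟩ i Z hi, hG ⟨V', h'.trans h⟩ i Z hi, resA_resA]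
      aug_on {V} h hn a := reg_ext π (fun i ↦ V ⊓ W i) (fun i ↦ inf_le_left)
        (by rw [← inf_iSup_eq]; exact le_inf le_rfl h) fun i ↦ by
          rw [← aug_resA, hG ⟨V, h⟩ i _ inf_le_right, GAut.aug_on, aug_resA] }
  refine ⟨T, fun i ↦ ?_, fun s hs ↦ ?_⟩
  · refine GAut.ext' (g := GAut.restrict π n (le_iSup W i) T) (g' := g i) fun V h a ↦ ?_
    have := hG ⟨V, h.trans (le_iSup W i)⟩ i V h le_rfl a
    rwa [resA_self, resA_self] at this
  · let s' : GAut π n (iSup W) := s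
    refine GAut.ext' (g := s') fun V h a ↦ aext h fun i Z hi hZ ↦ ?_
    refine Eq.trans ?_ (hG ⟨V, h⟩ i Z hi hZ a).symm
    rw [s'.resA_on]
    have : GAut.restrict π n (le_iSup W i) s' = g i := hs i
    exact congrArg (fun g : GAut π n (W i) ↦ g.on Z hi (resA π n hZ a)) this

/-- The sheaf of groups `𝒢_n` on `C`. -/
def 𝒢 (n : ℕ) : TopCat.Sheaf GrpCat.{0} C.toPresheafedSpace.carrier :=
  ⟨autPresheaf π n, autPresheaf_isSheaf π n⟩

/-! ### The restriction `ρ : 𝒢_n → 𝒢_m` -/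

theorem GAut.trunc_on {n m : ℕ} (h : m ≤ n) {U V : C.Opens} (g : GAut π n U) (hV : V ≤ U)
    {a : A π n V} (ha : trunc π h V a = 0) : trunc π h V (g.on V hV a) = 0 := by
  rw [trunc_eq_zero_iff] at ha ⊢
  obtain ⟨b, rfl⟩ := Ideal.mem_span_singleton.1 ha
  rw [map_mul, map_pow]
  refine Ideal.mul_mem_right _ _ ?_
  rw [← Ideal.span_singleton_pow]
  rcases eq_or_ne m 0 with rfl | hm
  · simp
  have hn : n ≠ 0 := by omega
  refine Ideal.pow_mem_pow ((aug_eq_zero_iff hn _).1 ?_) m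
  rw [GAut.aug_on, aug_eq_zero_iff]
  exact Ideal.mem_span_singleton_self _

/-- The endomorphism of `𝒜_m(V)` induced by a section of `𝒢_n`, for `m ≤ n`. -/
def GAut.induced {n m : ℕ} (h : m ≤ n) {U : C.Opens} (g : GAut π n U) (V : C.Opens) (hV : V ≤ U) :
    A π m V →ₐ[ℂ] A π m V :=
  (Ideal.Quotient.liftₐ (RingHom.ker (trunc π h V))
    ((trunc π h V).comp (g.on V hV).toAlgHom) fun _ ha ↦ g.trunc_on π h hV ha).comp
      (Ideal.quotientKerAlgEquivOfSurjective (trunc_surjective h)).symm.toAlgHom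

theorem GAut.induced_trunc {n m : ℕ} (h : m ≤ n) {U V : C.Opens} (g : GAut π n U) (hV : V ≤ U)
    (a : A π n V) : g.induced π h V hV (trunc π h V a) = trunc π h V (g.on V hV a) := by
  have : (Ideal.quotientKerAlgEquivOfSurjective (trunc_surjective h)).symm (trunc π h V a) =
      Ideal.Quotient.mk (RingHom.ker (trunc π h V)) a := by
    rw [AlgEquiv.symm_apply_eq]; rfl
  simp only [GAut.induced, AlgHom.comp_apply]
  erw [this]
  rfl

theorem GAut.induced_comp {n m : ℕ} (h : m ≤ n) {U V : C.Opens} (g : GAut π n U) (hV : V ≤ U) :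
    (g.induced π h V hV).comp (g⁻¹.induced π h V hV) = AlgHom.id ℂ _ := by
  refine AlgHom.ext fun a ↦ ?_
  obtain ⟨a, rfl⟩ := trunc_surjective h a
  rw [AlgHom.comp_apply, GAut.induced_trunc, GAut.induced_trunc, ← GAut.on_mul, mul_inv_cancel]
  rfl

/-- The group homomorphism `𝒢_n(U) → 𝒢_m(U)`, for `m ≤ n`: a section of `𝒢_n` preserves the kernel
of `𝒜_n → 𝒜_m`, so it induces a section of `𝒢_m`. -/
def GAut.rho {n m : ℕ} (h : m ≤ n) (U : C.Opens) : GAut π n U →* GAut π m U where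
  toFun g :=
    { on V hV := AlgEquiv.ofAlgHom (g.induced π h V hV) (g⁻¹.induced π h V hV)
        (g.induced_comp π h hV) (by
          have := g⁻¹.induced_comp π h hV
          rwa [inv_inv] at this)
      resA_on {V W} hV h' a := by
        obtain ⟨a, rfl⟩ := trunc_surjective h a
        change resA π m h' (g.induced π h V hV _) = g.induced π h W (h'.trans hV) _
        rw [GAut.induced_trunc, ← trunc_resA, ← trunc_resA, GAut.induced_trunc, GAut.resA_on]
      aug_on {V} hV hm a := by
        obtain ⟨a, rfl⟩ := trunc_surjective h a
        change aug π hm V (g.induced π h V hV _) = _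
        have hn : n ≠ 0 := by omega
        rw [GAut.induced_trunc, aug_trunc h hn, aug_trunc h hn, GAut.aug_on] }
  map_one' := by
    refine GAut.ext' fun V hV a ↦ ?_
    obtain ⟨a, rfl⟩ := trunc_surjective h a
    exact GAut.induced_trunc π h 1 hV a
  map_mul' g g' := by
    refine GAut.ext' fun V hV a ↦ ?_
    obtain ⟨a, rfl⟩ := trunc_surjective h a
    change (g * g').induced π h V hV _ = g.induced π h V hV (g'.induced π h V hV _)
    rw [GAut.induced_trunc, GAut.induced_trunc, GAut.induced_trunc, GAut.on_mul]

/-- The defining property of `ρ`. -/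
theorem GAut.rho_on {n m : ℕ} (h : m ≤ n) {U V : C.Opens} (g : GAut π n U) (hV : V ≤ U)
    (a : A π n V) :
    (GAut.rho π h U g).on V hV (trunc π h V a) = trunc π h V (g.on V hV a) :=
  g.induced_trunc π h hV a

/-- The morphism of sheaves of groups `ρ : 𝒢_n → 𝒢_m`, for `m ≤ n`. -/
def ρ {n m : ℕ} (h : m ≤ n) : 𝒢 π n ⟶ 𝒢 π m :=
  ⟨{ app := fun U ↦ GrpCat.ofHom (GAut.rho π h U.unop)
     naturality := fun _ _ _ ↦ rfl }⟩

/-! ### The sheaf of groups `T_C ⊕ 𝒪_C` -/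

/-- `T_C(U)`: the `ℂ`-derivations of the sheaf of `ℂ`-algebras `𝒪_C|_U` into itself, that is, the
homomorphisms `Ω_C|_U → 𝒪_C|_U`. -/
@[ext]
structure Tan (U : C.Opens) : Type where
  /-- the derivation of `𝒪_C(V)`, for `V ≤ U` -/
  on : ∀ V : C.Opens, V ≤ U → Derivation ℂ (Reg π V) (Reg π V)
  res_on : ∀ {V W : C.Opens} (h : V ≤ U) (h' : W ≤ V) (a : Reg π V),
    res π h' (on V h a) = on W (h'.trans h) (res π h' a)

theorem Tan.ext' {U : C.Opens} {D D' : Tan π U} (H : ∀ V h a, D.on V h a = D'.on V h a) :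
    D = D' :=
  Tan.ext (funext fun V ↦ funext fun h ↦ Derivation.ext (H V h))

/-- The addition of vector fields. -/
instance (U : C.Opens) : Add (Tan π U) where
  add D D' :=
    { on V h := D.on V h + D'.on V h
      res_on h h' a := by simp [D.res_on, D'.res_on] }

instance (U : C.Opens) : Zero (Tan π U) where
  zero := { on V h := 0, res_on h h' a := by simp }

instance (U : C.Opens) : Neg (Tan π U) where
  neg D := { on V h := -D.on V h, res_on h h' a := by simp [D.res_on] }

instance (U : C.Opens) : AddCommGroup (Tan π U) where
  add_assoc D D' D'' := Tan.ext' π fun V h a ↦ add_assoc (D.on V h a) _ _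
  zero_add D := Tan.ext' π fun V h a ↦ zero_add (D.on V h a)
  add_zero D := Tan.ext' π fun V h a ↦ add_zero (D.on V h a)
  neg_add_cancel D := Tan.ext' π fun V h a ↦ neg_add_cancel (D.on V h a)
  add_comm D D' := Tan.ext' π fun V h a ↦ add_comm (D.on V h a) _
  nsmul := nsmulRec
  zsmul := zsmulRec

/-- Multiplication of vector fields by functions. -/
instance (U : C.Opens) : SMul (Reg π U) (Tan π U) where
  smul θ D :=
    { on V h := res π h θ • D.on V h
      res_on h h' a := by simp [D.res_on, res_res] }

/-- The restriction `T_C(U) → T_C(V)` for `V ≤ U`. -/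
def Tan.restrict {U V : C.Opens} (h : V ≤ U) : Tan π U →+ Tan π V where
  toFun D :=
    { on W h' := D.on W (h'.trans h)
      res_on h' := D.res_on (h'.trans h) }
  map_zero' := rfl
  map_add' _ _ := rfl

/-- `T_C ⊕ 𝒪_C` as a presheaf of groups, the group law being addition. -/
def tanSumPresheaf : TopCat.Presheaf GrpCat.{0} C.toPresheafedSpace.carrier where
  obj U := GrpCat.of (Multiplicative (Tan π U.unop × Reg π U.unop))
  map i := GrpCat.ofHom (AddMonoidHom.toMultiplicative
    ((Tan.restrict π i.unop.le).prodMap (res π i.unop.le : _ →+ _)))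
  map_id _ := GrpCat.hom_ext <| MonoidHom.ext fun x ↦
    congrArg (fun y ↦ Multiplicative.ofAdd ((Multiplicative.toAdd x).1, y))
      (res_self π (Multiplicative.toAdd x).2)
  map_comp i j := GrpCat.hom_ext <| MonoidHom.ext fun x ↦
    congrArg (fun y ↦ Multiplicative.ofAdd (Tan.restrict π (i ≫ j).unop.le
      (Multiplicative.toAdd x).1, y)) (res_res π _ _ (Multiplicative.toAdd x).2).symm

theorem tanSumPresheaf_isSheaf : (tanSumPresheaf π).IsSheaf := by
  rw [TopCat.Presheaf.isSheaf_iff_isSheafUniqueGluing]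
  intro ι W sf hsf
  let D (i : ι) : Tan π (W i) := (Multiplicative.toAdd (sf i)).1
  let β (i : ι) : Reg π (W i) := (Multiplicative.toAdd (sf i)).2
  have cptD (i j : ι) : Tan.restrict π inf_le_left (D i) =
      Tan.restrict π (inf_le_right : W i ⊓ W j ≤ W j) (D j) :=
    congrArg (fun x ↦ (Multiplicative.toAdd x).1) (hsf i j)
  have cptβ (i j : ι) : res π inf_le_left (β i) =
      res π (inf_le_right : W i ⊓ W j ≤ W j) (β j) :=
    congrArg (fun x ↦ (Multiplicative.toAdd x).2) (hsf i j)
  obtain ⟨b, hb⟩ := reg_glue π (V := iSup W) W (le_iSup W) le_rfl β fun i j Z hi hj ↦ by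
    rw [← res_res π inf_le_left (le_inf hi hj), cptβ, res_res]
  have key := glue_end (F := Reg π) (fun h ↦ res π h) (res_res π) (reg_ext π) (reg_glue π) W
    (fun i Z h ↦ (D i).on Z h) (fun i Z Z' h h' a ↦ (D i).res_on h h' a)
    (fun i j Z hi hj a ↦
      congrArg (fun g : Tan π (W i ⊓ W j) ↦ g.on Z (le_inf hi hj) a) (cptD i j))
  choose E hE using key
  have aext {V : C.Opens} (hV : V ≤ iSup W) {a b : Reg π V}
      (h : ∀ i Z (_ : Z ≤ W i) (hZ : Z ≤ V), res π hZ a = res π hZ b) : a = b :=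
    reg_ext π (fun i ↦ V ⊓ W i) (fun i ↦ inf_le_left)
      (by rw [← inf_iSup_eq]; exact le_inf le_rfl hV) fun i ↦ h i _ inf_le_right _
  let G (V : {V : C.Opens // V ≤ iSup W}) : Derivation ℂ (Reg π V.1) (Reg π V.1) :=
    Derivation.mk'
      { toFun := E V.1 V.2
        map_add' a b := aext V.2 fun i Z hi hZ ↦ by
          rw [map_add, hE V.1 V.2 i Z hi hZ, hE V.1 V.2 i Z hi hZ, hE V.1 V.2 i Z hi hZ,
            map_add, map_add]
        map_smul' c a := aext V.2 fun i Z hi hZ ↦ by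
          rw [RingHom.id_apply, map_smul, hE V.1 V.2 i Z hi hZ, hE V.1 V.2 i Z hi hZ,
            map_smul, Derivation.map_smul] }
      fun a b ↦ aext V.2 fun i Z hi hZ ↦ by
        simp only [LinearMap.coe_mk, AddHom.coe_mk, smul_eq_mul, map_add, map_mul]
        rw [hE V.1 V.2 i Z hi hZ, hE V.1 V.2 i Z hi hZ, hE V.1 V.2 i Z hi hZ, map_mul,
          Derivation.leibniz, smul_eq_mul, smul_eq_mul]
  have hG (V : {V : C.Opens // V ≤ iSup W}) (i : ι) (Z : C.Opens) (hi : Z ≤ W i) (hZ : Z ≤ V.1)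
      (a : Reg π V.1) : res π hZ (G V a) = (D i).on Z hi (res π hZ a) :=
    hE V.1 V.2 i Z hi hZ a
  have hGT (V V' : {V : C.Opens // V ≤ iSup W}) (h : V'.1 ≤ V.1) (a : Reg π V.1) :
      res π h (G V a) = G V' (res π h a) := by
    refine aext V'.2 fun i Z hi hZ ↦ ?_
    rw [res_res, hG V i Z hi, hG V' i Z hi, res_res]
  let T : Tan π (iSup W) := ⟨fun V h ↦ G ⟨V, h⟩, fun h h' a ↦ hGT ⟨_, h⟩ ⟨_, h'.trans h⟩ h' a⟩
  have hT (i : ι) : Tan.restrict π (le_iSup W i) T = D i := by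
    refine Tan.ext' π fun V h a ↦ ?_
    have := hG ⟨V, h.trans (le_iSup W i)⟩ i V h le_rfl a
    rwa [res_self, res_self] at this
  refine ⟨Multiplicative.ofAdd (T, b), fun i ↦ ?_, fun s hs ↦ ?_⟩
  · exact congrArg Multiplicative.ofAdd (Prod.ext (hT i) (hb i))
  · let s' : Tan π (iSup W) × Reg π (iSup W) := Multiplicative.toAdd s
    have h1 (i : ι) : Tan.restrict π (le_iSup W i) s'.1 = D i :=
      congrArg (fun x ↦ (Multiplicative.toAdd x).1) (hs i)
    have h2 (i : ι) : res π (le_iSup W i) s'.2 = β i :=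
      congrArg (fun x ↦ (Multiplicative.toAdd x).2) (hs i)
    refine congrArg Multiplicative.ofAdd (Prod.ext (x := s') ?_ ?_)
    · refine Tan.ext' π fun V h a ↦ aext h fun i Z hi hZ ↦ ?_
      refine Eq.trans ?_ (hG ⟨V, h⟩ i Z hi hZ a).symm
      rw [s'.1.res_on]
      exact congrArg (fun g : Tan π (W i) ↦ g.on Z hi (res π hZ a)) (h1 i)
    · exact reg_ext π W (le_iSup W) le_rfl fun i ↦ by rw [h2, hb]

/-- The sheaf of groups `T_C ⊕ 𝒪_C` on `C`. -/
def tanSum : TopCat.Sheaf GrpCat.{0} C.toPresheafedSpace.carrier :=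
  ⟨tanSumPresheaf π, tanSumPresheaf_isSheaf π⟩

/-- The group homomorphism `T_C(U) ⊕ 𝒪_C(U) → 𝒢_n(U)` given by a morphism of sheaves of groups
`T_C ⊕ 𝒪_C → 𝒢_n`. -/
def sec {n : ℕ} (lam : tanSum π ⟶ 𝒢 π n) (U : C.Opens) :
    Multiplicative (Tan π U × Reg π U) →* GAut π n U :=
  (lam.hom.app (op U)).hom

/-! ### The automorphisms `φ_{μν}` -/

/-- `g = φ_{μν}` relative to the vector field `σ` on `U`: for every open `V ⊆ U`,
`g(α) = ∑ₖ (1/k!) σᵏ(α) (μt)ᵏ` for `α ∈ 𝒪_C(V)`, and `g(t) = νt`.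
The powers `tᵏ` with `k ≥ n` vanish, and only the classes of `μ`, `ν` modulo `t^(n-1)` matter. -/
def IsPhi {n : ℕ} {U : C.Opens} (σ : Tan π U) (μ ν : A π n U) (g : GAut π n U) : Prop :=
  ∀ (V : C.Opens) (h : V ≤ U),
    (∀ α : Reg π V, g.on V h (incl π n V α) =
      ∑ k ∈ Finset.range n, ((k.factorial : ℂ)⁻¹) •
        (incl π n V ((σ.on V h)^[k] α) * (resA π n h μ * t π n V) ^ k)) ∧
    g.on V h (t π n V) = resA π n h ν * t π n V

/-- `φ_{μν}` is uniquely determined by `σ`, `μ`, `ν`. -/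
theorem IsPhi.unique {n : ℕ} {U : C.Opens} {σ : Tan π U} {μ ν : A π n U} {g g' : GAut π n U}
    (hg : IsPhi π σ μ ν g) (hg' : IsPhi π σ μ ν g') : g = g' := by
  refine GAut.ext' fun V h a ↦ ?_
  have : (g.on V h).toAlgHom.toRingHom = (g'.on V h).toAlgHom.toRingHom :=
    ringHom_ext (fun α ↦ ((hg V h).1 α).trans ((hg' V h).1 α).symm)
      ((hg V h).2.trans (hg' V h).2.symm)
  exact congrArg (fun f ↦ f a) this

end

end PrimitiveCurves

/-!
A section of `ker ρ_n` is congruent to the identity modulo the square-zero ideal `(t^(n-1)) ≅ 𝒪_C`,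
so it is `α ↦ α + D(α) t^(n-1)`, `t ↦ t + β t^(n-1)` for a derivation `D` and a function `β`. Modulo
`t^2` such a map is the identity when `n ≥ 3`; it therefore fixes `(t^(n-1))` pointwise, and
composition adds the pairs `(D, β)`.

For the local surjectivity, let `V` be affine. Since `𝒪_C(V)` is formally smooth over `ℂ`, an
automorphism of `𝒜_{n-1}(V)` and its inverse lift to endomorphisms of `𝒜_n(V)`; both composites of
the two lifts are unipotent, hence bijective, so the lifts are automorphisms. An endomorphism of
`𝒜_n(V)` compatible with the projection to `𝒪_C(V)` sends a function `f` to a section that is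
invertible on `D(f)`, because it is so modulo the nilpotent `t`; hence it extends uniquely to the
localisations `𝒜_n(D(f))`, and then to the sheaf `𝒜_n|_V`.
-/

namespace PrimitiveCurves

noncomputable section

theorem map_sub_self_mem_pow_succ {B : Type*} [CommRing B] {I : Ideal B} {e : B →+* B}
    (he : ∀ x, e x - x ∈ I ^ 2) (j : ℕ) {x : B} (hx : x ∈ I ^ j) : e x - x ∈ I ^ (j + 1) := by
  induction j generalizing x with
  | zero => simpa using Ideal.pow_le_self two_ne_zero (he x)
  | succ j ih =>
    rw [pow_succ] at hx
    induction hx using Submodule.mul_induction_on' with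
    | mem_mul_mem y hy z hz =>
      have he_z : e z ∈ I := by
        simpa using I.add_mem (Ideal.pow_le_self two_ne_zero (he z)) hz
      have h₁ : (e y - y) * e z ∈ I ^ (j + 2) := by
        rw [pow_succ]; exact Ideal.mul_mem_mul (ih hy) he_z
      have h₂ : y * (e z - z) ∈ I ^ (j + 2) := by
        rw [pow_add]; exact Ideal.mul_mem_mul hy (he z)
      convert! add_mem h₁ h₂ using 1
      rw [map_mul]; ring
    | add y _ z _ hy hz =>
      convert! add_mem hy hz using 1
      rw [map_add]; ring

theorem bijective_of_map_sub_self_mem {B : Type*} [CommRing B] {I : Ideal B}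
    (hI : IsNilpotent I) {e : B →+* B} (he : ∀ x, e x - x ∈ I ^ 2) : Function.Bijective e := by
  obtain ⟨n, hn⟩ := hI
  let N : Module.End ℤ B := e.toAddMonoidHom.toIntLinearMap - 1
  have N_pow_mem (j : ℕ) (x : B) : (N ^ j) x ∈ I ^ j := by
    induction j with
    | zero => simp
    | succ j ih =>
      rw [pow_succ' N, Module.End.mul_apply]
      exact map_sub_self_mem_pow_succ he j ih
  have hN : IsNilpotent N := ⟨n, LinearMap.ext fun x ↦ by simpa [hn] using N_pow_mem n x⟩
  have := (Module.End.isUnit_iff _).1 hN.isUnit_one_add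
  rwa [add_sub_cancel] at this

/-! ### Truncated polynomial rings -/

/-- The truncated polynomial ring `R[t]/(t^n)`, so that `𝒜_n(U)` is `TruncPoly (Reg π U) n`. -/
abbrev TruncPoly (R : Type*) [CommRing R] (n : ℕ) : Type _ := AdjoinRoot (X ^ n : R[X])

namespace TruncPoly

variable {k R : Type*} [CommRing k] [CommRing R] [Algebra k R] {m n : ℕ}

/-- The class of `t` in `R[t]/(t^n)`. -/
abbrev root (R : Type*) [CommRing R] (n : ℕ) : TruncPoly R n := AdjoinRoot.root _

/-- The inclusion of the constants `R → R[t]/(t^n)`. -/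
abbrev const (n : ℕ) : R →+* TruncPoly R n := AdjoinRoot.of _

theorem algHom_ext {B : Type*} [CommRing B] [Algebra k B] {f g : TruncPoly R n →ₐ[k] B}
    (h_const : ∀ a, f (const n a) = g (const n a)) (h_root : f (root R n) = g (root R n)) :
    f = g :=
  AdjoinRoot.algHom_ext' (AlgHom.ext h_const) h_root

theorem root_pow_eq_zero (h : n ≤ m) : root R n ^ m = 0 := by
  refine pow_eq_zero_of_le h ?_
  simpa using AdjoinRoot.eval₂_root (X ^ n : R[X])

theorem exists_eq_const_add_root_mul (x : TruncPoly R n) :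
    ∃ a y, x = const n a + root R n * y := by
  obtain ⟨p, rfl⟩ := AdjoinRoot.mk_surjective x
  refine ⟨p.coeff 0, AdjoinRoot.mk _ p.divX, ?_⟩
  calc AdjoinRoot.mk (X ^ n) p = AdjoinRoot.mk (X ^ n) (p.divX * X + C (p.coeff 0)) := by
        rw [divX_mul_X_add]
    _ = _ := by rw [map_add, map_mul, AdjoinRoot.mk_X, AdjoinRoot.mk_C, add_comm, mul_comm]

theorem span_root_pow_pred_sq (hn : 2 ≤ n) : Ideal.span {root R n ^ (n - 1)} ^ 2 = ⊥ := by
  rw [Ideal.span_singleton_pow, ← pow_mul, root_pow_eq_zero (by omega), Ideal.span_singleton_zero]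

theorem smul_root_pow_pred_injective (hn : n ≠ 0) :
    Function.Injective fun a : R ↦ a • root R n ^ (n - 1) := by
  refine (injective_iff_map_eq_zero (LinearMap.toSpanSingleton R _ (root R n ^ (n - 1)))).2
    fun a ha ↦ ?_
  have ha' : AdjoinRoot.mk (X ^ n : R[X]) (C a * X ^ (n - 1)) = 0 := by
    simpa [Algebra.smul_def] using ha
  simpa using X_pow_dvd_iff.1 (AdjoinRoot.mk_eq_zero.1 ha') (n - 1) (by omega)

theorem mem_span_root_pow_pred_iff {x : TruncPoly R n} :
    x ∈ Ideal.span {root R n ^ (n - 1)} ↔ ∃ a : R, a • root R n ^ (n - 1) = x := by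
  rw [Ideal.mem_span_singleton']
  constructor
  · rintro ⟨y, rfl⟩
    obtain ⟨a, z, rfl⟩ := exists_eq_const_add_root_mul y
    have h_top : root R n * root R n ^ (n - 1) = 0 := by
      rw [← pow_succ', root_pow_eq_zero (by omega)]
    refine ⟨a, ?_⟩
    rw [add_mul, mul_right_comm, h_top, zero_mul, add_zero, Algebra.smul_def]
    rfl
  · rintro ⟨a, rfl⟩
    exact ⟨const n a, (Algebra.smul_def _ _).symm⟩

/-- The isomorphism `a ↦ a t^(n-1)` of `R` onto the ideal `(t^(n-1))` of `R[t]/(t^n)`. -/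
def topEquiv (hn : n ≠ 0) : R ≃ₗ[R] Ideal.span {root R n ^ (n - 1)} :=
  LinearEquiv.ofBijective
    (LinearMap.codRestrict ((Ideal.span {root R n ^ (n - 1)}).restrictScalars R)
      (LinearMap.toSpanSingleton R _ (root R n ^ (n - 1)))
      fun a ↦ mem_span_root_pow_pred_iff.2 ⟨a, rfl⟩)
    ⟨fun _ _ h ↦ smul_root_pow_pred_injective hn (congrArg Subtype.val h),
      fun x ↦ (mem_span_root_pow_pred_iff.1 x.2).imp fun _ h ↦ Subtype.ext h⟩

theorem coe_topEquiv (hn : n ≠ 0) (a : R) :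
    (topEquiv hn a : TruncPoly R n) = a • root R n ^ (n - 1) := rfl

/-- The endomorphism `a ↦ a + D(a) t^(n-1)`, `t ↦ t + β t^(n-1)` of `R[t]/(t^n)`. -/
def infinitesimalEnd (hn : 2 ≤ n) (D : Derivation k R R) (β : R) :
    TruncPoly R n →ₐ[k] TruncPoly R n :=
  AdjoinRoot.liftAlgHom _
    (liftOfDerivationToSquareZero _ (span_root_pow_pred_sq hn)
      ((topEquiv (Nat.ne_zero_of_lt hn)).toLinearMap.compDer D))
    (root R n + β • root R n ^ (n - 1)) (by
      have h_root_dvd : root R n ∣ root R n + β • root R n ^ (n - 1) :=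
        dvd_add dvd_rfl (dvd_smul_of_dvd _ (dvd_pow_self _ (by omega)))
      rw [eval₂_pow, eval₂_X, ← zero_dvd_iff, ← root_pow_eq_zero (R := R) le_rfl]
      exact pow_dvd_pow_of_dvd h_root_dvd n)

theorem infinitesimalEnd_const (hn : 2 ≤ n) (D : Derivation k R R) (β a : R) :
    infinitesimalEnd hn D β (const n a) = const n a + D a • root R n ^ (n - 1) :=
  (AdjoinRoot.liftAlgHom_of ..).trans (add_comm _ _)

theorem infinitesimalEnd_root (hn : 2 ≤ n) (D : Derivation k R R) (β : R) :
    infinitesimalEnd hn D β (root R n) = root R n + β • root R n ^ (n - 1) :=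
  AdjoinRoot.liftAlgHom_root ..

theorem infinitesimalEnd_sub_self_mem (hn : 2 ≤ n) (D : Derivation k R R) (β : R)
    (x : TruncPoly R n) : infinitesimalEnd hn D β x - x ∈ Ideal.span {root R n ^ (n - 1)} := by
  have smul_mem (a : R) : a • root R n ^ (n - 1) ∈ Ideal.span {root R n ^ (n - 1)} :=
    mem_span_root_pow_pred_iff.2 ⟨a, rfl⟩
  have : (Ideal.Quotient.mkₐ k (Ideal.span {root R n ^ (n - 1)})).comp (infinitesimalEnd hn D β) =
      Ideal.Quotient.mkₐ k _ := by
    refine algHom_ext (fun a ↦ Ideal.Quotient.eq.2 ?_) (Ideal.Quotient.eq.2 ?_)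
    · change infinitesimalEnd hn D β _ - _ ∈ _
      rw [infinitesimalEnd_const, add_sub_cancel_left]; exact smul_mem _
    · change infinitesimalEnd hn D β _ - _ ∈ _
      rw [infinitesimalEnd_root, add_sub_cancel_left]; exact smul_mem _
  exact Ideal.Quotient.eq.1 (DFunLike.congr_fun this x)

theorem exists_eq_infinitesimalEnd (hn : 2 ≤ n) (e : TruncPoly R n →ₐ[k] TruncPoly R n)
    (he : ∀ x, e x - x ∈ Ideal.span {root R n ^ (n - 1)}) :
    ∃ (D : Derivation k R R) (β : R), e = infinitesimalEnd hn D β := by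
  have hn₀ : n ≠ 0 := by omega
  let d : Derivation k R (Ideal.span {root R n ^ (n - 1)}) :=
    derivationToSquareZeroOfLift _ (span_root_pow_pred_sq hn) (e.comp (AdjoinRoot.ofAlgHom k _))
      (AlgHom.ext fun a ↦ Ideal.Quotient.eq.2 (he (const n a)))
  have hd (a : R) : (d a : TruncPoly R n) = e (const n a) - const n a := rfl
  refine ⟨(topEquiv hn₀).symm.toLinearMap.compDer d, (topEquiv hn₀).symm ⟨_, he (root R n)⟩,
    algHom_ext (fun a ↦ ?_) ?_⟩
  · rw [infinitesimalEnd_const, ← coe_topEquiv hn₀, Derivation.coe_comp]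
    simp [hd]
  · rw [infinitesimalEnd_root, ← coe_topEquiv hn₀]
    simp

theorem span_root_pow_le_sq (hm : 2 ≤ m) :
    Ideal.span {root R n ^ m} ≤ Ideal.span {root R n} ^ 2 := by
  rw [← Ideal.span_singleton_pow]
  exact Ideal.pow_le_pow_right hm

theorem isNilpotent_span_root_pow (hm : m ≠ 0) : IsNilpotent (Ideal.span {root R n ^ m}) :=
  ⟨n, by
    rw [Ideal.span_singleton_pow, ← pow_mul,
      root_pow_eq_zero (Nat.le_mul_of_pos_left n (Nat.pos_of_ne_zero hm)),
      Ideal.span_singleton_zero, Ideal.zero_eq_bot]⟩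

theorem bijective_of_map_sub_self_mem_span (hm : 2 ≤ m)
    {e : TruncPoly R n →+* TruncPoly R n} (he : ∀ x, e x - x ∈ Ideal.span {root R n ^ m}) :
    Function.Bijective e :=
  bijective_of_map_sub_self_mem (by simpa using isNilpotent_span_root_pow (R := R) one_ne_zero)
    fun x ↦ span_root_pow_le_sq hm (he x)

theorem infinitesimalEnd_smul_root_pow_pred (hn : 2 < n) (D : Derivation k R R) (β a : R) :
    infinitesimalEnd hn.le D β (a • root R n ^ (n - 1)) = a • root R n ^ (n - 1) := by
  have h_mem : a • root R n ^ (n - 1) ∈ Ideal.span {root R n} ^ (n - 1) := by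
    rw [Ideal.span_singleton_pow]
    exact mem_span_root_pow_pred_iff.2 ⟨a, rfl⟩
  -- The map is the identity modulo `(t)^2`, hence on the graded piece `(t)^(n-1) / (t)^n`.
  have := map_sub_self_mem_pow_succ (e := (infinitesimalEnd hn.le D β).toRingHom)
    (fun x ↦ span_root_pow_le_sq (by omega) (infinitesimalEnd_sub_self_mem _ D β x)) _ h_mem
  rw [Nat.sub_add_cancel (by omega), Ideal.span_singleton_pow, root_pow_eq_zero le_rfl,
    Ideal.span_singleton_zero] at this
  exact sub_eq_zero.1 this

theorem infinitesimalEnd_comp (hn : 2 < n) (D D' : Derivation k R R) (β β' : R) :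
    (infinitesimalEnd hn.le D β).comp (infinitesimalEnd hn.le D' β') =
      infinitesimalEnd hn.le (D + D') (β + β') := by
  refine algHom_ext (fun a ↦ ?_) ?_
  · rw [AlgHom.comp_apply, infinitesimalEnd_const, map_add,
      infinitesimalEnd_smul_root_pow_pred hn, infinitesimalEnd_const, infinitesimalEnd_const,
      Derivation.add_apply, add_smul, add_assoc]
  · rw [AlgHom.comp_apply, infinitesimalEnd_root, map_add,
      infinitesimalEnd_smul_root_pow_pred hn, infinitesimalEnd_root, infinitesimalEnd_root,
      add_smul, add_assoc]

theorem infinitesimalEnd_zero (hn : 2 ≤ n) :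
    infinitesimalEnd hn (0 : Derivation k R R) 0 = AlgHom.id k _ :=
  algHom_ext (fun a ↦ by rw [infinitesimalEnd_const]; simp)
    (by rw [infinitesimalEnd_root]; simp)

/-- `infinitesimalEnd hn.le D β` as an automorphism, with inverse given by `(-D, -β)`. -/
def infinitesimalAut (hn : 2 < n) (D : Derivation k R R) (β : R) :
    TruncPoly R n ≃ₐ[k] TruncPoly R n :=
  AlgEquiv.ofAlgHom (infinitesimalEnd hn.le D β) (infinitesimalEnd hn.le (-D) (-β))
    (by rw [infinitesimalEnd_comp hn, add_neg_cancel, add_neg_cancel, infinitesimalEnd_zero])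
    (by rw [infinitesimalEnd_comp hn, neg_add_cancel, neg_add_cancel, infinitesimalEnd_zero])

theorem exists_lift [Algebra.FormallySmooth k R] {B B' : Type*} [CommRing B] [Algebra k B]
    [CommRing B'] [Algebra k B'] {p : B' →ₐ[k] B} (hp : Function.Surjective p)
    (hp' : IsNilpotent (RingHom.ker p)) (f : TruncPoly R n →ₐ[k] B) {τ : B'}
    (hτ : p τ = f (root R n)) (hτ' : τ ^ n = 0) :
    ∃ F : TruncPoly R n →ₐ[k] B', p.comp F = f := by
  let F₀ : R →ₐ[k] B' :=
    Algebra.FormallySmooth.liftOfSurjective (f.comp (AdjoinRoot.ofAlgHom k _)) p hp hp'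
  refine ⟨AdjoinRoot.liftAlgHom _ F₀ τ (by rw [eval₂_pow, eval₂_X, hτ']),
    algHom_ext (fun a ↦ ?_) ?_⟩
  · rw [AlgHom.comp_apply, AdjoinRoot.liftAlgHom_of]
    exact Algebra.FormallySmooth.liftOfSurjective_apply ..
  · rw [AlgHom.comp_apply, AdjoinRoot.liftAlgHom_root, hτ]

end TruncPoly

/-! ### The kernel of `ρ` -/

open TruncPoly

variable {C : Scheme.{0}} {π : C ⟶ Spec (CommRingCat.of ℂ)} {m n : ℕ} {U V W : C.Opens}

theorem resA_smul (h : V ≤ U) (a : Reg π U) (x : A π n U) :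
    resA π n h (a • x) = res π h a • resA π n h x := by
  rw [Algebra.smul_def, Algebra.smul_def, map_mul]
  exact congrArg (· * _) (resA_incl h a)

theorem resA_infinitesimalEnd_iff (hn : 2 ≤ n) (h : V ≤ U)
    {D : Derivation ℂ (Reg π U) (Reg π U)} {β : Reg π U}
    {D' : Derivation ℂ (Reg π V) (Reg π V)} {β' : Reg π V} :
    (∀ x, resA π n h (infinitesimalEnd hn D β x) = infinitesimalEnd hn D' β' (resA π n h x)) ↔
      (∀ a, res π h (D a) = D' (res π h a)) ∧ res π h β = β' := by
  have h_incl (a : Reg π U) : resA π n h (infinitesimalEnd hn D β (incl π n U a)) =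
      incl π n V (res π h a) + res π h (D a) • t π n V ^ (n - 1) := by
    rw [infinitesimalEnd_const, map_add, resA_incl, resA_smul, map_pow, resA_t]
  have h_t : resA π n h (infinitesimalEnd hn D β (t π n U)) =
      t π n V + res π h β • t π n V ^ (n - 1) := by
    rw [infinitesimalEnd_root, map_add, resA_smul, map_pow, resA_t]
  have inj := smul_root_pow_pred_injective (R := Reg π V) (Nat.ne_zero_of_lt hn)
  constructor
  · refine fun H ↦ ⟨fun a ↦ inj ?_, inj ?_⟩
    · have := H (incl π n U a)
      rw [h_incl, resA_incl, infinitesimalEnd_const] at this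
      exact add_left_cancel this
    · have := H (t π n U)
      rw [h_t, resA_t, infinitesimalEnd_root] at this
      exact add_left_cancel this
  · rintro ⟨hD, hβ⟩ x
    have : (resA π n h).comp (infinitesimalEnd hn D β) =
        (infinitesimalEnd hn D' β').comp (resA π n h) := by
      refine algHom_ext (fun a ↦ ?_) ?_
      · rw [AlgHom.comp_apply, AlgHom.comp_apply, h_incl, resA_incl, infinitesimalEnd_const, hD]
      · rw [AlgHom.comp_apply, AlgHom.comp_apply, h_t, resA_t, infinitesimalEnd_root, hβ]
    exact DFunLike.congr_fun this x

theorem aug_eq_of_sub_mem (hn : n ≠ 0) (hm : m ≠ 0) {x y : A π n V}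
    (h : x - y ∈ Ideal.span {t π n V ^ m}) : aug π hn V x = aug π hn V y := by
  rw [← sub_eq_zero, ← map_sub, aug_eq_zero_iff]
  exact Ideal.span_singleton_le_span_singleton.2 (dvd_pow_self _ hm) h

namespace GAut

/-- The section `α ↦ α + D(α) t^(n-1)`, `t ↦ t + β t^(n-1)` of `𝒢_n` given by a vector field `D`
and a function `β`. -/
def infinitesimal (hn : 2 < n) (D : Tan π U) (β : Reg π U) : GAut π n U where
  on V h := infinitesimalAut hn (D.on V h) (res π h β)
  resA_on h h' := (resA_infinitesimalEnd_iff hn.le h').2 ⟨D.res_on h h', res_res π h h' β⟩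
  aug_on h hn' x := aug_eq_of_sub_mem hn' (by omega) (infinitesimalEnd_sub_self_mem hn.le _ _ x)

theorem infinitesimal_on (hn : 2 < n) (D : Tan π U) (β : Reg π U) (h : V ≤ U) (x : A π n V) :
    (infinitesimal hn D β).on V h x = infinitesimalEnd hn.le (D.on V h) (res π h β) x := rfl

theorem infinitesimal_add (hn : 2 < n) (D D' : Tan π U) (β β' : Reg π U) :
    infinitesimal hn (D + D') (β + β') = infinitesimal hn D β * infinitesimal hn D' β' := by
  refine GAut.ext' fun V h x ↦ ?_
  rw [on_mul, infinitesimal_on, infinitesimal_on, infinitesimal_on, ← AlgHom.comp_apply,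
    infinitesimalEnd_comp hn, map_add]
  rfl

theorem infinitesimal_injective (hn : 2 < n) {D D' : Tan π U} {β β' : Reg π U}
    (h : infinitesimal hn D β = infinitesimal hn D' β') : D = D' ∧ β = β' := by
  have key (V : C.Opens) (hV : V ≤ U) := (resA_infinitesimalEnd_iff hn.le le_rfl).1
    fun x ↦ (resA_self _).trans <|
      (DFunLike.congr_fun (congrArg (fun g : GAut π n U ↦ g.on V hV) h) x).trans <|
        congrArg _ (resA_self x).symm
  refine ⟨Tan.ext' π fun V hV a ↦ ?_, ?_⟩
  · simpa only [res_self] using (key V hV).1 a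
  · simpa only [res_self] using (key U le_rfl).2

theorem mem_ker_rho_iff (h : m ≤ n) {g : GAut π n U} : g ∈ (GAut.rho π h U).ker ↔
    ∀ V hV x, g.on V hV x - x ∈ Ideal.span {t π n V ^ m} := by
  simp only [← trunc_eq_zero_iff h, map_sub, sub_eq_zero, ← rho_on, MonoidHom.mem_ker]
  refine ⟨fun hg V hV x ↦ by rw [hg]; rfl, fun hg ↦ GAut.ext' fun V hV x ↦ ?_⟩
  obtain ⟨x, rfl⟩ := trunc_surjective h x
  exact hg V hV x

theorem mem_ker_rho_iff_exists_infinitesimal (hn : 2 < n) {g : GAut π n U} :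
    g ∈ (GAut.rho π (Nat.sub_le n 1) U).ker ↔
      ∃ (D : Tan π U) (β : Reg π U), infinitesimal hn D β = g := by
  rw [mem_ker_rho_iff]
  refine ⟨fun hg ↦ ?_, ?_⟩
  · choose D β hDβ using fun (V : C.Opens) (hV : V ≤ U) ↦
      exists_eq_infinitesimalEnd hn.le (g.on V hV : A π n V →ₐ[ℂ] A π n V) (hg V hV)
    have g_on (V hV) (x : A π n V) : g.on V hV x = infinitesimalEnd hn.le (D V hV) (β V hV) x :=
      DFunLike.congr_fun (hDβ V hV) x
    have compat (V W : C.Opens) (hV : V ≤ U) (h : W ≤ V) :=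
      (resA_infinitesimalEnd_iff hn.le h).1 fun x ↦ by
        rw [← g_on V hV, g.resA_on, g_on W (h.trans hV)]
    refine ⟨⟨D, fun hV h ↦ (compat _ _ hV h).1⟩, β U le_rfl, GAut.ext' fun V hV x ↦ ?_⟩
    rw [infinitesimal_on, (compat U V le_rfl hV).2, g_on]
  · rintro ⟨D, β, rfl⟩ V hV x
    exact infinitesimalEnd_sub_self_mem hn.le _ _ x

theorem isPhi_infinitesimal (hn : 2 < n) (σ : Tan π U) (θ β : Reg π U) :
    IsPhi π σ (incl π n U θ * t π n U ^ (n - 2)) (1 + incl π n U β * t π n U ^ (n - 2))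
      (infinitesimal hn (θ • σ) β) := by
  obtain ⟨m, rfl⟩ : ∃ m, n = m + 2 := ⟨n - 2, by omega⟩
  have incl_mul {V : C.Opens} (a : Reg π V) (x : A π (m + 2) V) : incl π _ V a * x = a • x :=
    (Algebra.smul_def a x).symm
  intro V h
  have e : t π (m + 2) V ^ m * t π (m + 2) V = t π (m + 2) V ^ (m + 1) := (pow_succ ..).symm
  simp only [infinitesimal_on, Nat.add_sub_cancel, map_add, map_one, incl_mul, resA_smul,
    map_pow, resA_t, smul_mul_assoc, e, add_mul, one_mul]
  refine ⟨fun α ↦ ?_, infinitesimalEnd_root ..⟩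
  rw [Finset.sum_range_succ', Finset.sum_range_succ', Finset.sum_eq_zero fun k _ ↦ ?_]
  · rw [infinitesimalEnd_const, ← mul_one (const _ α), incl_mul]
    change _ + (res π h θ * σ.on V h α) • _ = _
    simp [smul_smul, mul_comm, add_comm]
  · rw [_root_.smul_pow, ← pow_mul, root_pow_eq_zero (by nlinarith), smul_zero, smul_zero,
      smul_zero]

/-- `(D, β) ↦ infinitesimal D β` as a group homomorphism `T_C(U) ⊕ 𝒪_C(U) → 𝒢_n(U)`. -/
def infinitesimalHom (hn : 2 < n) (U : C.Opens) :
    Multiplicative (Tan π U × Reg π U) →* GAut π n U :=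
  MonoidHom.mk' (fun x ↦ infinitesimal hn x.toAdd.1 x.toAdd.2) fun _ _ ↦ infinitesimal_add hn ..

theorem infinitesimalHom_injective (hn : 2 < n) :
    Function.Injective (infinitesimalHom (π := π) hn U) := fun _ _ h ↦
  have ⟨hD, hβ⟩ := infinitesimal_injective hn h
  congrArg Multiplicative.ofAdd (Prod.ext hD hβ)

theorem range_infinitesimalHom (hn : 2 < n) :
    (infinitesimalHom hn U).range = (GAut.rho π (Nat.sub_le n 1) U).ker := by
  ext g
  rw [mem_ker_rho_iff_exists_infinitesimal hn, MonoidHom.mem_range]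
  exact ⟨fun ⟨x, hx⟩ ↦ ⟨_, _, hx⟩, fun ⟨D, β, h⟩ ↦ ⟨Multiplicative.ofAdd (D, β), h⟩⟩

theorem restrict_infinitesimal (hn : 2 < n) (h : V ≤ U) (D : Tan π U) (β : Reg π U) :
    restrict π n h (infinitesimal hn D β) =
      infinitesimal hn (Tan.restrict π h D) (res π h β) := by
  refine GAut.ext' fun W h' x ↦ ?_
  rw [infinitesimal_on, res_res]
  rfl

end GAut

variable (π) in
/-- The morphism of sheaves of groups `λ : T_C ⊕ 𝒪_C → 𝒢_n`. -/
def lambda (hn : 2 < n) : tanSum π ⟶ 𝒢 π n :=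
  ⟨{ app := fun U ↦ GrpCat.ofHom (GAut.infinitesimalHom hn U.unop)
     naturality := fun _ _ i ↦ GrpCat.hom_ext <| MonoidHom.ext fun x ↦
      (GAut.restrict_infinitesimal hn i.unop.le x.toAdd.1 x.toAdd.2).symm }⟩

theorem mul_comm_of_mem_ker_rho (hn : 2 < n) {g g' : GAut π n U}
    (hg : g ∈ (GAut.rho π (Nat.sub_le n 1) U).ker)
    (hg' : g' ∈ (GAut.rho π (Nat.sub_le n 1) U).ker) : g * g' = g' * g := by
  rw [← GAut.range_infinitesimalHom hn] at hg hg'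
  obtain ⟨x, rfl⟩ := hg
  obtain ⟨x', rfl⟩ := hg'
  rw [← map_mul, mul_comm, map_mul]

/-! ### Local surjectivity of `ρ` -/

theorem isUnit_of_isUnit_aug (hn : n ≠ 0) {x : A π n V} (hx : IsUnit (aug π hn V x)) :
    IsUnit x := by
  have h_sub : x - incl π n V (aug π hn V x) ∈ Ideal.span {t π n V} := by
    rw [← aug_eq_zero_iff hn]
    simp [aug]
  obtain ⟨y, hy⟩ := Ideal.mem_span_singleton.1 h_sub
  rw [sub_eq_iff_eq_add'.1 hy]
  refine IsNilpotent.isUnit_add_left_of_commute ⟨n, ?_⟩ (hx.map _) (Commute.all _ _)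
  rw [mul_pow, t_pow, zero_mul]

variable (π) in
theorem formallySmooth_reg [Smooth π] (hV : IsAffineOpen V) :
    Algebra.FormallySmooth ℂ (Reg π V) := by
  have h_appLE : (π.appLE ⊤ V le_top).hom.Smooth := π.smooth_appLE (isAffineOpen_top _) hV le_top
  have h_ΓSpec : (Scheme.ΓSpecIso (CommRingCat.of ℂ)).inv.hom.Smooth :=
    RingHom.Smooth.of_bijective (ConcreteCategory.bijective_of_isIso _)
  have h_algebraMap : (algebraMap ℂ (Reg π V)).Smooth := h_ΓSpec.comp h_appLE
  rw [RingHom.smooth_algebraMap] at h_algebraMap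
  infer_instance

variable (π) in
/-- The open subset `D(f) ⊆ V` where `f ∈ 𝒪_C(V)` is invertible; this is `Scheme.basicOpen` for a
section of type `Reg π V`. -/
def basicOpen (f : Reg π V) : C.Opens := C.basicOpen (show Γ(C, V) from f)

theorem basicOpen_le (f : Reg π V) : basicOpen π f ≤ V := C.basicOpen_le _

theorem isUnit_res_basicOpen (f : Reg π V) : IsUnit (res π (basicOpen_le f) f) :=
  RingedSpace.isUnit_res_basicOpen _ _

theorem le_iSup_basicOpen (hV : IsAffineOpen V) (hW : W ≤ V) :
    W ≤ ⨆ f : {f : Reg π V // basicOpen π f ≤ W}, basicOpen π f.1 := fun x hx ↦ by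
  obtain ⟨f, hf, hx'⟩ : ∃ f : Reg π V, basicOpen π f ≤ W ∧ x ∈ basicOpen π f :=
    hV.exists_basicOpen_le ⟨x, hx⟩ (hW hx)
  exact Opens.mem_iSup.2 ⟨⟨f, hf⟩, hx'⟩

theorem A_ext_basicOpen (hV : IsAffineOpen V) (hW : W ≤ V) {x y : A π n W}
    (h : ∀ (f : Reg π V) (hf : basicOpen π f ≤ W), resA π n hf x = resA π n hf y) : x = y :=
  A_ext _ (fun f ↦ f.2) (le_iSup_basicOpen hV hW) fun f ↦ h f.1 f.2

theorem A_glue_basicOpen (hV : IsAffineOpen V) (hW : W ≤ V)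
    (s : ∀ f : Reg π V, basicOpen π f ≤ W → A π n (basicOpen π f))
    (hs : ∀ f g hf hg (h : basicOpen π g ≤ basicOpen π f), resA π n h (s f hf) = s g hg) :
    ∃ x : A π n W, ∀ f hf, resA π n hf x = s f hf := by
  obtain ⟨x, hx⟩ := A_glue _ (fun f ↦ f.2) (le_iSup_basicOpen hV hW) (fun f ↦ s f.1 f.2)
    fun f g Z hf hg ↦ A_ext_basicOpen hV (hf.trans (f.2.trans hW)) fun d hd ↦ by
      have hdW : basicOpen π d ≤ W := hd.trans (hf.trans f.2)
      rw [resA_resA, resA_resA, hs _ _ _ hdW, hs _ _ _ hdW]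
  exact ⟨x, fun f hf ↦ hx ⟨f, hf⟩⟩

theorem ringHom_basicOpen_ext {R : Type*} [CommRing R] (hV : IsAffineOpen V) {f : Reg π V}
    {φ ψ : Reg π (basicOpen π f) →+* R}
    (h : ∀ a, φ (res π (basicOpen_le f) a) = ψ (res π (basicOpen_le f) a)) : φ = ψ := by
  have := hV.isLocalization_basicOpen f
  exact @IsLocalization.ringHom_ext Γ(C, V) _ (.powers (show Γ(C, V) from f))
    Γ(C, C.basicOpen (show Γ(C, V) from f)) _ _ _ R _ φ ψ (RingHom.ext h)

theorem exists_ringHom_basicOpen {R : Type*} [CommRing R] (hV : IsAffineOpen V) {f : Reg π V}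
    (φ : Reg π V →+* R) (hf : IsUnit (φ f)) :
    ∃ ψ : Reg π (basicOpen π f) →+* R, ∀ a, ψ (res π (basicOpen_le f) a) = φ a := by
  have := hV.isLocalization_basicOpen f
  exact ⟨IsLocalization.Away.lift (S := Γ(C, C.basicOpen (show Γ(C, V) from f)))
    (show Γ(C, V) from f) hf, IsLocalization.Away.lift_eq
      (S := Γ(C, C.basicOpen (show Γ(C, V) from f))) (show Γ(C, V) from f) hf⟩

theorem algHom_basicOpen_ext {R : Type*} [CommRing R] [Algebra ℂ R] (hV : IsAffineOpen V)
    {f : Reg π V} {φ ψ : A π n (basicOpen π f) →ₐ[ℂ] R}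
    (h : φ.comp (resA π n (basicOpen_le f)) = ψ.comp (resA π n (basicOpen_le f))) : φ = ψ := by
  have h_incl : φ.toRingHom.comp (incl π n _) = ψ.toRingHom.comp (incl π n _) :=
    ringHom_basicOpen_ext hV fun a ↦ by
      simpa using DFunLike.congr_fun h (incl π n V a)
  exact algHom_ext (RingHom.congr_fun h_incl) (by simpa using DFunLike.congr_fun h (t π n V))

theorem exists_algHom_basicOpen {R : Type*} [CommRing R] [Algebra ℂ R] (hV : IsAffineOpen V)
    {f : Reg π V} (φ : A π n V →ₐ[ℂ] R) (hf : IsUnit (φ (incl π n V f))) :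
    ∃ ψ : A π n (basicOpen π f) →ₐ[ℂ] R, ψ.comp (resA π n (basicOpen_le f)) = φ := by
  obtain ⟨ψ₀, hψ₀⟩ := exists_ringHom_basicOpen hV (φ.toRingHom.comp (incl π n V)) hf
  let ψ₁ : Reg π (basicOpen π f) →ₐ[ℂ] R :=
    { ψ₀ with
      commutes' c := by
        rw [← φ.commutes, ← (res π (basicOpen_le f)).commutes]
        exact hψ₀ _ }
  refine ⟨AdjoinRoot.liftAlgHom _ ψ₁ (φ (t π n V)) ?_, algHom_ext (fun a ↦ ?_) ?_⟩
  · rw [eval₂_pow, eval₂_X, ← map_pow, t_pow, map_zero]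
  · rw [AlgHom.comp_apply, resA_incl, AdjoinRoot.liftAlgHom_of]
    exact hψ₀ a
  · rw [AlgHom.comp_apply, resA_t, AdjoinRoot.liftAlgHom_root]

/-- A family of `ℂ`-algebra endomorphisms of the `𝒜_n(W)`, `W ⊆ V`, is an endomorphism of the sheaf
`𝒜_n|_V`. -/
def IsSheafEnd (E : ∀ W, W ≤ V → (A π n W →ₐ[ℂ] A π n W)) : Prop :=
  ∀ ⦃W W' : C.Opens⦄ (hW : W ≤ V) (h : W' ≤ W) (x : A π n W),
    resA π n h (E W hW x) = E W' (h.trans hW) (resA π n h x)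

namespace IsSheafEnd

variable {E E' : ∀ W, W ≤ V → (A π n W →ₐ[ℂ] A π n W)}

theorem comp (hE : IsSheafEnd E) (hE' : IsSheafEnd E') :
    IsSheafEnd fun W hW ↦ (E W hW).comp (E' W hW) := fun W W' hW h x ↦ by
  rw [AlgHom.comp_apply, AlgHom.comp_apply, hE, hE']

theorem id : IsSheafEnd fun W (_ : W ≤ V) ↦ AlgHom.id ℂ (A π n W) := fun _ _ _ _ _ ↦ rfl

theorem incl_comp_aug (hn : n ≠ 0) :
    IsSheafEnd fun W (_ : W ≤ V) ↦ (AdjoinRoot.ofAlgHom ℂ _).comp (aug π hn W) :=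
  fun W W' hW h x ↦ by
    rw [AlgHom.comp_apply, AlgHom.comp_apply, aug_resA]
    exact resA_incl h _

theorem ext (hE : IsSheafEnd E) (hE' : IsSheafEnd E') (hV : IsAffineOpen V)
    (h : E V le_rfl = E' V le_rfl) (hW : W ≤ V) : E W hW = E' W hW := by
  have h_basicOpen (f : Reg π V) : E _ (basicOpen_le f) = E' _ (basicOpen_le f) :=
    algHom_basicOpen_ext hV <| AlgHom.ext fun x ↦ by
      rw [AlgHom.comp_apply, AlgHom.comp_apply, ← hE le_rfl, ← hE' le_rfl, h]
  refine AlgHom.ext fun x ↦ A_ext_basicOpen hV hW fun f hf ↦ ?_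
  rw [hE, hE', h_basicOpen]

theorem aug_apply (hE : IsSheafEnd E) (hV : IsAffineOpen V) (hn : n ≠ 0)
    (h : ∀ x, aug π hn V (E V le_rfl x) = aug π hn V x) (hW : W ≤ V) (x : A π n W) :
    aug π hn W (E W hW x) = aug π hn W x := by
  -- An equality of sheaf endomorphisms, `incl ∘ aug ∘ E = incl ∘ aug`, can be checked on `V`.
  have h_comp := ((incl_comp_aug hn).comp hE).ext (incl_comp_aug hn) hV
    (AlgHom.ext fun x ↦ congrArg (incl π n V) (h x)) hW
  simpa [aug] using congrArg (aug π hn W) (DFunLike.congr_fun h_comp x)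

end IsSheafEnd

theorem exists_isSheafEnd_of_basicOpen (hV : IsAffineOpen V)
    (ψ : ∀ f : Reg π V, A π n (basicOpen π f) →ₐ[ℂ] A π n (basicOpen π f))
    (hψ : ∀ f g (h : basicOpen π g ≤ basicOpen π f) x,
      resA π n h (ψ f x) = ψ g (resA π n h x)) :
    ∃ E : ∀ W, W ≤ V → (A π n W →ₐ[ℂ] A π n W), IsSheafEnd E ∧
      ∀ W hW (f : Reg π V) (hf : basicOpen π f ≤ W) x,
        resA π n hf (E W hW x) = ψ f (resA π n hf x) := by
  choose E hE using fun (W : C.Opens) (hW : W ≤ V) (x : A π n W) ↦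
    A_glue_basicOpen hV hW (fun f hf ↦ ψ f (resA π n hf x))
      fun f g hf hg h ↦ by rw [hψ, resA_resA]
  refine ⟨fun W hW ↦
    { toFun := E W hW
      map_one' := A_ext_basicOpen hV hW fun f hf ↦ by rw [hE, map_one, map_one]
      map_zero' := A_ext_basicOpen hV hW fun f hf ↦ by rw [hE, map_zero, map_zero]
      map_add' x y := A_ext_basicOpen hV hW fun f hf ↦ by
        rw [map_add, hE, hE, hE, map_add, map_add]
      map_mul' x y := A_ext_basicOpen hV hW fun f hf ↦ by
        rw [map_mul, hE, hE, hE, map_mul, map_mul]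
      commutes' c := A_ext_basicOpen hV hW fun f hf ↦ by
        rw [hE, AlgHom.commutes, AlgHom.commutes] },
    fun W W' hW h x ↦ A_ext_basicOpen hV (h.trans hW) fun f hf ↦ ?_,
    fun W hW f hf x ↦ hE W hW x f hf⟩
  change resA π n hf (resA π n h (E W hW x)) = resA π n hf (E W' _ _)
  rw [resA_resA, hE, hE, resA_resA]

theorem exists_isSheafEnd (hn : n ≠ 0) (hV : IsAffineOpen V) (e : A π n V →ₐ[ℂ] A π n V)
    (he : ∀ x, aug π hn V (e x) = aug π hn V x) :
    ∃ E : ∀ W, W ≤ V → (A π n W →ₐ[ℂ] A π n W), IsSheafEnd E ∧ E V le_rfl = e := by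
  have e_incl_isUnit (f : Reg π V) :
      IsUnit ((resA π n (basicOpen_le f)).comp e (incl π n V f)) :=
    isUnit_of_isUnit_aug hn <| by
      rw [AlgHom.comp_apply, aug_resA, he]
      simpa [aug] using isUnit_res_basicOpen f
  choose ψ hψ using fun f ↦ exists_algHom_basicOpen hV _ (e_incl_isUnit f)
  have ψ_res (f : Reg π V) (x : A π n V) :
      ψ f (resA π n (basicOpen_le f) x) = resA π n (basicOpen_le f) (e x) :=
    DFunLike.congr_fun (hψ f) x
  have compat (f g : Reg π V) (h : basicOpen π g ≤ basicOpen π f) :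
      (resA π n h).comp (ψ f) = (ψ g).comp (resA π n h) :=
    algHom_basicOpen_ext hV <| AlgHom.ext fun x ↦ by
      simp only [AlgHom.comp_apply, ψ_res, resA_resA]
  obtain ⟨E, hE, hEψ⟩ := exists_isSheafEnd_of_basicOpen hV ψ
    fun f g h ↦ DFunLike.congr_fun (compat f g h)
  refine ⟨E, hE, AlgHom.ext fun x ↦ A_ext_basicOpen hV le_rfl fun f hf ↦ ?_⟩
  rw [hEψ, ψ_res]

namespace GAut

theorem isSheafEnd (g : GAut π n V) : IsSheafEnd fun W hW ↦ (g.on W hW : A π n W →ₐ[ℂ] A π n W) :=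
  fun _ _ hW h ↦ g.resA_on hW h

theorem ext_of_isAffineOpen (hV : IsAffineOpen V) {g g' : GAut π n V}
    (h : g.on V le_rfl = g'.on V le_rfl) : g = g' :=
  GAut.ext' fun _ hW x ↦ DFunLike.congr_fun (g.isSheafEnd.ext g'.isSheafEnd hV
    (AlgHom.ext fun y ↦ DFunLike.congr_fun h y) hW) x

theorem exists_on_eq (hn : n ≠ 0) (hV : IsAffineOpen V) (e : A π n V ≃ₐ[ℂ] A π n V)
    (he : ∀ x, aug π hn V (e x) = aug π hn V x) : ∃ g : GAut π n V, g.on V le_rfl = e := by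
  obtain ⟨E, hE, hEV⟩ := exists_isSheafEnd hn hV (e : A π n V →ₐ[ℂ] A π n V) he
  obtain ⟨E', hE', hE'V⟩ :=
    exists_isSheafEnd hn hV (e.symm : A π n V →ₐ[ℂ] A π n V) fun x ↦ by
      rw [← he]; exact congrArg _ (e.apply_symm_apply x)
  refine ⟨
    { on W hW := AlgEquiv.ofAlgHom (E W hW) (E' W hW)
        ((hE.comp hE').ext .id hV (by rw [hEV, hE'V]; exact e.comp_symm) hW)
        ((hE'.comp hE).ext .id hV (by rw [hEV, hE'V]; exact e.symm_comp) hW)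
      resA_on := @hE
      aug_on hW hn' := hE.aug_apply hV hn' (by rw [hEV]; exact he) hW }, ?_⟩
  exact AlgEquiv.ext fun x ↦ DFunLike.congr_fun hEV x

end GAut

theorem exists_algHom_lift [Smooth π] (hV : IsAffineOpen V) (h : m ≤ n) (hm : m ≠ 0)
    (f : A π m V →ₐ[ℂ] A π m V) (hf : ∀ x, aug π hm V (f x) = aug π hm V x) :
    ∃ e : A π n V →ₐ[ℂ] A π n V, (trunc π h V).comp e = f.comp (trunc π h V) := by
  have := formallySmooth_reg π hV
  have hn : n ≠ 0 := by omega
  have ker_trunc : RingHom.ker (trunc π h V) = Ideal.span {t π n V ^ m} :=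
    Ideal.ext fun x ↦ trunc_eq_zero_iff h x
  obtain ⟨τ, hτ⟩ := trunc_surjective h (f (t π m V))
  have aug_τ : aug π hn V τ = 0 := by
    rw [← aug_trunc h hn hm, hτ, hf]
    simp [aug]
  obtain ⟨d, rfl⟩ := Ideal.mem_span_singleton.1 ((aug_eq_zero_iff hn _).1 aug_τ)
  refine TruncPoly.exists_lift (trunc_surjective h) (ker_trunc ▸ isNilpotent_span_root_pow hm) _
    (τ := t π n V * d) ?_ ?_
  · rw [hτ, AlgHom.comp_apply, trunc_t]
  · rw [mul_pow, t_pow, zero_mul]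

theorem exists_algEquiv_lift [Smooth π] (hV : IsAffineOpen V) (h : m ≤ n) (hm : 2 ≤ m)
    (f : A π m V ≃ₐ[ℂ] A π m V)
    (hf : ∀ x, aug π (Nat.ne_zero_of_lt hm) V (f x) = aug π (Nat.ne_zero_of_lt hm) V x) :
    ∃ e : A π n V ≃ₐ[ℂ] A π n V, ∀ x, trunc π h V (e x) = f (trunc π h V x) := by
  obtain ⟨e, he⟩ := exists_algHom_lift hV h _ (f : A π m V →ₐ[ℂ] A π m V) hf
  obtain ⟨e', he'⟩ := exists_algHom_lift hV h _ (f.symm : A π m V →ₐ[ℂ] A π m V) fun x ↦ by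
    rw [← hf]; exact congrArg _ (f.apply_symm_apply x)
  replace he (x) : trunc π h V (e x) = f (trunc π h V x) := DFunLike.congr_fun he x
  replace he' (x) : trunc π h V (e' x) = f.symm (trunc π h V x) := DFunLike.congr_fun he' x
  have bijective_of_trunc (u : A π n V →ₐ[ℂ] A π n V)
      (hu : ∀ x, trunc π h V (u x) = trunc π h V x) : Function.Bijective u :=
    bijective_of_map_sub_self_mem_span hm (e := u.toRingHom) fun x ↦ by
      rw [← trunc_eq_zero_iff h, map_sub, sub_eq_zero]
      exact hu x
  have hee' := bijective_of_trunc (e.comp e') fun x ↦ by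
    rw [AlgHom.comp_apply, he, he', AlgEquiv.apply_symm_apply]
  have he'e := bijective_of_trunc (e'.comp e) fun x ↦ by
    rw [AlgHom.comp_apply, he', he, AlgEquiv.symm_apply_apply]
  exact ⟨AlgEquiv.ofBijective e
    ⟨.of_comp (f := e') he'e.injective, .of_comp (g := e') hee'.surjective⟩, he⟩

theorem GAut.exists_rho_eq [Smooth π] (hV : IsAffineOpen V) (h : m ≤ n) (hm : 2 ≤ m)
    (g : GAut π m V) : ∃ g' : GAut π n V, GAut.rho π h V g' = g := by
  have hm₀ : m ≠ 0 := Nat.ne_zero_of_lt hm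
  have hn₀ : n ≠ 0 := by omega
  obtain ⟨e, he⟩ := exists_algEquiv_lift hV h hm (g.on V le_rfl) (g.aug_on le_rfl _)
  obtain ⟨g', hg'⟩ := GAut.exists_on_eq hn₀ hV e fun x ↦ by
    rw [← aug_trunc h hn₀ hm₀, he, g.aug_on, aug_trunc h hn₀ hm₀]
  refine ⟨g', GAut.ext_of_isAffineOpen hV (AlgEquiv.ext fun x ↦ ?_)⟩
  obtain ⟨x, rfl⟩ := trunc_surjective h x
  rw [rho_on, hg', he]

theorem isLocallySurjective_rho [Smooth π] (h : m ≤ n) (hm : 2 ≤ m) :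
    TopCat.Presheaf.IsLocallySurjective (ρ π h).hom := by
  rw [TopCat.Presheaf.isLocallySurjective_iff]
  intro U g x hx
  obtain ⟨V, hV, hxV, hVU⟩ := exists_isAffineOpen_mem_and_subset hx
  obtain ⟨g', hg'⟩ := GAut.exists_rho_eq hV h hm (GAut.restrict π m hVU g)
  exact ⟨V, hVU, ⟨g', hg'⟩, hxV⟩

end

end PrimitiveCurves

open PrimitiveCurves in
theorem proposition4p4p2_general {C : Scheme.{0}} (π : C ⟶ Spec (CommRingCat.of ℂ)) [Smooth π]
    (n : ℕ) (hn : 3 ≤ n) :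
    (∀ (U : C.Opens), ∀ g ∈ (GAut.rho π (Nat.sub_le n 1) U).ker,
      ∀ g' ∈ (GAut.rho π (Nat.sub_le n 1) U).ker, g * g' = g' * g) ∧
    ∃ lam : tanSum π ⟶ 𝒢 π n,
      (∀ (U : C.Opens) (σ : Tan π U) (θ β : Reg π U),
        IsPhi π σ (incl π n U θ * t π n U ^ (n - 2)) (1 + incl π n U β * t π n U ^ (n - 2))
          (sec π lam U (Multiplicative.ofAdd (θ • σ, β)))) ∧
      (∀ U : C.Opens, Function.Injective (sec π lam U)) ∧
      (∀ U : C.Opens, (sec π lam U).range = (GAut.rho π (Nat.sub_le n 1) U).ker) ∧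
      TopCat.Presheaf.IsLocallySurjective (ρ π (Nat.sub_le n 1)).hom :=
  ⟨fun _ _ hg _ hg' ↦ mul_comm_of_mem_ker_rho hn hg hg', lambda π hn,
    fun _ ↦ GAut.isPhi_infinitesimal hn, fun _ ↦ GAut.infinitesimalHom_injective hn,
    fun _ ↦ GAut.range_infinitesimalHom hn, isLocallySurjective_rho _ (Nat.le_sub_one_of_lt hn)⟩

theorem proposition4p4p2 {C : Scheme.{0}} (π : C ⟶ Spec (CommRingCat.of ℂ))
    [SmoothOfRelativeDimension 1 π] (n : ℕ) (hn : 3 ≤ n) :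
    -- the kernel of `ρ_n` is abelian
    (∀ (U : C.Opens), ∀ g ∈ (PrimitiveCurves.GAut.rho π (Nat.sub_le n 1) U).ker,
      ∀ g' ∈ (PrimitiveCurves.GAut.rho π (Nat.sub_le n 1) U).ker, g * g' = g' * g) ∧
    ∃ lam : PrimitiveCurves.tanSum π ⟶ PrimitiveCurves.𝒢 π n,
      -- `lam (θσ, β) = φ_{θt^(n-2), 1+βt^(n-2)}` relative to `σ`
      (∀ (U : C.Opens) (σ : PrimitiveCurves.Tan π U) (θ β : PrimitiveCurves.Reg π U),
        PrimitiveCurves.IsPhi π σ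
          (PrimitiveCurves.incl π n U θ * PrimitiveCurves.t π n U ^ (n - 2))
          (1 + PrimitiveCurves.incl π n U β * PrimitiveCurves.t π n U ^ (n - 2))
          (PrimitiveCurves.sec π lam U (Multiplicative.ofAdd (θ • σ, β)))) ∧
      -- `0 → T_C ⊕ 𝒪_C → 𝒢_n → 𝒢_{n-1} → 0` is exact
      (∀ U : C.Opens, Function.Injective (PrimitiveCurves.sec π lam U)) ∧
      (∀ U : C.Opens, (PrimitiveCurves.sec π lam U).range =
        (PrimitiveCurves.GAut.rho π (Nat.sub_le n 1) U).ker) ∧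
      TopCat.Presheaf.IsLocallySurjective (PrimitiveCurves.ρ π (Nat.sub_le n 1)).hom := by
  have := SmoothOfRelativeDimension.smooth 1 π
  exact proposition4p4p2_general π n hn
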